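/- \textbf{Lower bound for EL-LCS-RLE.} A run-length-encoded (RLE) string $S$ of encoded length $n$ over an alphabet $\Sigma$ is a sequence $S[1]\cdots S[n]$ of runs; the run $S[i]$ consists of $R(S[i])\ge 1$ copies of the character $C(S[i])\in\Sigma$, and $C(S[i])\neq C(S[i+1])$. The decoded string $\tilde S$ is the concatenation of these runs. A substring is contiguous, and a longest common substring (LCS) of two strings is a common substring of maximum length. In the problem $\mathsf{EL\text{-}LCS\text{-}RLE}$, given two RLE strings $A$ and $B$, one has to output the encoded length $|s|$ of some RLE string $s$ such that $\tilde s$ is an LCS of $\tilde A$ and $\tilde B$ (if there are several LCSs, the encoded length of any of them is a correct answer). A quantum query algorithm accesses $S\in\{A,B\}$ only through the oracle $$O_S:\ |i\rangle|c\rangle|r\rangle\mapsto|i\rangle|c\oplus C(S[i])\rangle|r\oplus R(S[i])\rangle,$$ where characters and run lengths are written as bit strings and $\oplus$ is bitwise XOR; in particular it has no oracle for the prefix sums $\sum_{j\le i}R(S[j])$. Each application of $O_A$ or $O_B$ (possibly controlled, or at a superposition of the two) is one query. Between queries the algorithm applies arbitrary unitaries that do not depend on the input, on its registers and a finite-dimensional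 workspace, and it outputs a function of a final measurement; it may depend on $n$, on the alphabet and on a bound for the decoded lengths. There are absolute constants $c>0$ and $n_0$ such that the following holds for all $n\ge n_0$, every finite alphabet $\Sigma$ with at least five characters and every $N\ge 8n$: any quantum query algorithm that, for every pair $A,B$ of RLE strings over $\Sigma$ of encoded length $n$ and decoded length at most $N$, outputs a correct answer to $\mathsf{EL\text{-}LCS\text{-}RLE}$ with probability at least $2/3$ makes at least $c\,n/\log^2 n$ queries. In other words, without prefix-sum oracles $\mathsf{EL\text{-}LCS\text{-}RLE}$ requires $\Omega(n/\log^2 n)$ quantum queries, already on inputs of linear decoded length. -/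

import Mathlib

/-- A run-length-encoded string over `α` of encoded length `n`: its `i`-th run consists of
`run i ≥ 1` copies of the character `char i`, and the runs are maximal, so that consecutive runs
have different characters. -/
structure RLEString (α : Type) (n : ℕ) where
  char : Fin n → α
  run : Fin n → ℕ
  run_pos : ∀ i, 1 ≤ run i
  char_ne : ∀ (i : ℕ) (h : i + 1 < n), char ⟨i, by omega⟩ ≠ char ⟨i + 1, h⟩

/-- The decoded string of an RLE string. -/
def RLEString.decode {α : Type} {n : ℕ} (S : RLEString α n) : List α :=
  (List.ofFn fun i => List.replicate (S.run i) (S.char i)).flatten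

/-- `s` is a longest common (contiguous) substring of `u` and `v`. -/
def IsLongestCommonSubstring {α : Type} (s u v : List α) : Prop :=
  s <:+: u ∧ s <:+: v ∧ ∀ t : List α, t <:+: u → t <:+: v → t.length ≤ s.length

/-- `l` is a correct answer to the problem EL-LCS-RLE on the input `(A, B)`: it is the encoded
length of an RLE string whose decoded string is a longest common substring of the decoded strings
of `A` and `B`. -/
def IsEncodedLengthOfLCS {α : Type} {n : ℕ} (A B : RLEString α n) (l : ℕ) : Prop :=
  ∃ s : RLEString α l, IsLongestCommonSubstring s.decode A.decode B.decode

/-- Computational basis states of a query algorithm for two RLE strings of encoded length `n`: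
an address register, a character register of `b` bits, a run-length register of `w` bits and a
workspace of dimension `k`. The address `some (false, i)` is the `i`-th run of the first string,
`some (true, i)` is the `i`-th run of the second string; at the address `none` a query does
nothing, which allows controlled queries. -/
abbrev QueryBasis (n b w k : ℕ) : Type :=
  Option (Bool × Fin n) × BitVec b × BitVec w × Fin k

/-- The action of one query on basis states:
`|i⟩|c⟩|r⟩ ↦ |i⟩|c ⊕ C(S[i])⟩|r ⊕ R(S[i])⟩`, where `S` is the first or the second string, as the
address tells. Characters are written in binary by `code`, run lengths in base two. -/
def queryAction {α : Type} {n b w : ℕ} (k : ℕ) (code : α ↪ BitVec b) (A B : RLEString α n) :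
    QueryBasis n b w k → QueryBasis n b w k
  | (none, c, r, z) => (none, c, r, z)
  | (some (false, i), c, r, z) =>
      (some (false, i), c ^^^ code (A.char i), r ^^^ BitVec.ofNat w (A.run i), z)
  | (some (true, i), c, r, z) =>
      (some (true, i), c ^^^ code (B.char i), r ^^^ BitVec.ofNat w (B.run i), z)

/-- The query operator, `|x⟩ ↦ |queryAction x⟩`, as a matrix. -/
def queryMatrix {α : Type} {n b w : ℕ} (k : ℕ) (code : α ↪ BitVec b) (A B : RLEString α n) :
    Matrix (QueryBasis n b w k) (QueryBasis n b w k) ℂ :=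
  Matrix.of fun y x => if y = queryAction k code A B x then 1 else 0

/-- A quantum query algorithm with output in `ℕ`: it starts in a computational basis state,
applies `unitary 0`, query, `unitary 1`, query, ..., query, `unitary queries` (further values of
`unitary` are not used), then measures in the computational basis and reads the answer off the
outcome. -/
structure QueryAlgorithm (n b w k : ℕ) where
  queries : ℕ
  init : QueryBasis n b w k
  unitary : ℕ → Matrix.unitaryGroup (QueryBasis n b w k) ℂ
  output : QueryBasis n b w k → ℕ

namespace QueryAlgorithm

variable {α : Type} {n b w k : ℕ}

/-- The state of the algorithm on the input `(A, B)` after `t` queries and the unitary that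
follows the last of them. -/
noncomputable def state (Q : QueryAlgorithm n b w k) (code : α ↪ BitVec b) (A B : RLEString α n) :
    ℕ → QueryBasis n b w k → ℂ
  | 0 => Matrix.mulVec (Q.unitary 0).1 (Pi.single Q.init 1)
  | t + 1 => Matrix.mulVec (Q.unitary (t + 1)).1
      (Matrix.mulVec (queryMatrix k code A B) (Q.state code A B t))

open Classical in
/-- The probability that the answer on the input `(A, B)` satisfies `P`. -/
noncomputable def outputProb (Q : QueryAlgorithm n b w k) (code : α ↪ BitVec b)
    (A B : RLEString α n) (P : ℕ → Prop) : ℝ :=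
  ∑ x : QueryBasis n b w k, if P (Q.output x) then ‖Q.state code A B Q.queries x‖ ^ 2 else 0

/-- The algorithm solves EL-LCS-RLE with probability at least `2/3` on all pairs of RLE strings of
encoded length `n` and decoded length at most `N`. -/
def SolvesELLCSRLE (Q : QueryAlgorithm n b w k) (code : α ↪ BitVec b) (N : ℕ) : Prop :=
  ∀ A B : RLEString α n, A.decode.length ≤ N → B.decode.length ≤ N →
    2 / 3 ≤ Q.outputProb code A B (IsEncodedLengthOfLCS A B)

end QueryAlgorithm

/-! Take m = n - 1 bits x of weight |x| and the inputs u cˢ and cˢ u, where u alternates two letters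
other than c in runs of length 1 + 2xᵢ. A common substring lies in u or is a power of c
(`common_infix_cases`), so the LCS is the longer of u and cˢ. For s = m + 2t + 1 the answer is at
least 2 exactly when t < |x|, so one algorithm computes every threshold function of |x|.

By the polynomial method (`outputProb_mem_lowDegree`), T queries give output probabilities of degree
at most 2T. Iterating the polynomial 3p² - 2p³ for O(log log n) rounds brings each error below
1/(2m) and multiplies the degree by O(log² n). The alternating sum of the thresholds over t is then
closer than 1/2 to the parity bit of x, while parity is orthogonal to all functions of degree below
m. Hence m = O(T log² n) (`le_degree_of_approx_thresholds`). -/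

/-! ### Functions of low degree on the Boolean cube -/

/-- The functions on the cube of degree at most `d`: the span of the functions of at most `d`
coordinates. -/
def lowDegree (m d : ℕ) : Submodule ℂ ((Fin m → Bool) → ℂ) :=
  Submodule.span ℂ {f | ∃ S : Finset (Fin m), S.card ≤ d ∧
    ∀ x y, (∀ i ∈ S, x i = y i) → f x = f y}

namespace lowDegree

variable {m : ℕ}

theorem of_junta {d : ℕ} {f : (Fin m → Bool) → ℂ} (S : Finset (Fin m)) (hS : S.card ≤ d)
    (hf : ∀ x y, (∀ i ∈ S, x i = y i) → f x = f y) : f ∈ lowDegree m d :=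
  Submodule.subset_span ⟨S, hS, hf⟩

theorem const (d : ℕ) (c : ℂ) : (fun _ => c) ∈ lowDegree m d :=
  of_junta ∅ (by simp) fun _ _ _ => rfl

theorem mul {d e : ℕ} {f g : (Fin m → Bool) → ℂ} (hf : f ∈ lowDegree m d)
    (hg : g ∈ lowDegree m e) : (fun x => f x * g x) ∈ lowDegree m (d + e) := by
  have h : f * g ∈ lowDegree m d * lowDegree m e := Submodule.mul_mem_mul hf hg
  rw [lowDegree, lowDegree, Submodule.span_mul_span] at h
  refine Submodule.span_mono ?_ h
  rintro _ ⟨f, ⟨S, hS, hf⟩, g, ⟨T, hT, hg⟩, rfl⟩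
  classical
  refine ⟨S ∪ T, (Finset.card_union_le S T).trans (by omega), fun x y hxy => ?_⟩
  have h1 := hf x y fun i hi => hxy i (Finset.mem_union_left _ hi)
  have h2 := hg x y fun i hi => hxy i (Finset.mem_union_right _ hi)
  simp [h1, h2]

theorem mono {d e : ℕ} (h : d ≤ e) : lowDegree m d ≤ lowDegree m e :=
  Submodule.span_mono fun _ ⟨S, hS, hf⟩ => ⟨S, hS.trans h, hf⟩

theorem conj {d : ℕ} {f : (Fin m → Bool) → ℂ} (hf : f ∈ lowDegree m d) :
    (fun x => (starRingEnd ℂ) (f x)) ∈ lowDegree m d := by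
  induction hf using Submodule.span_induction with
  | mem f hf =>
    obtain ⟨S, hS, hf⟩ := hf
    exact of_junta S hS fun x y hxy => by rw [hf x y hxy]
  | zero => simpa using const (m := m) d 0
  | add f g _ _ hf hg => simpa only [Pi.add_apply, map_add] using! add_mem hf hg
  | smul c f _ hf =>
    simpa only [Pi.smul_apply, smul_eq_mul, map_mul] using!
      Submodule.smul_mem _ ((starRingEnd ℂ) c) hf

theorem sum {ι : Type*} {d : ℕ} (s : Finset ι) (f : ι → (Fin m → Bool) → ℂ)
    (hf : ∀ i ∈ s, f i ∈ lowDegree m d) : (fun x => ∑ i ∈ s, f i x) ∈ lowDegree m d := by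
  have h := Submodule.sum_mem _ hf
  convert h using 1
  ext x
  simp

end lowDegree

/-- The number of ones of a point of the cube. -/
def cubeWeight {m : ℕ} (x : Fin m → Bool) : ℕ := ∑ i, (x i).toNat

theorem cubeWeight_le {m : ℕ} (x : Fin m → Bool) : cubeWeight x ≤ m := by
  have := Finset.sum_le_card_nsmul Finset.univ (fun i => (x i).toNat) 1
    fun i _ => Bool.toNat_le (x i)
  simpa [cubeWeight] using this

theorem neg_one_pow_cubeWeight_update {m : ℕ} (x : Fin m → Bool) (i : Fin m) :
    (-1 : ℂ) ^ cubeWeight (Function.update x i (!x i)) = -(-1 : ℂ) ^ cubeWeight x := by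
  have h : ∀ y : Fin m → Bool, cubeWeight y = (y i).toNat +
      ∑ j ∈ Finset.univ.erase i, (y j).toNat := fun y =>
    (Finset.add_sum_erase _ (fun j => (y j).toNat) (Finset.mem_univ i)).symm
  rw [h, h x, Finset.sum_congr rfl fun j hj => by
    rw [Function.update_of_ne (Finset.ne_of_mem_erase hj)], Function.update_self, pow_add, pow_add]
  cases x i <;> simp

/-- A function of degree less than `m` is orthogonal to the parity of `m` bits. -/
theorem sum_parity_mul_eq_zero {m d : ℕ} (hd : d < m) {f : (Fin m → Bool) → ℂ}
    (hf : f ∈ lowDegree m d) : ∑ x, (-1 : ℂ) ^ cubeWeight x * f x = 0 := by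
  induction hf using Submodule.span_induction with
  | mem f hf =>
    obtain ⟨S, hS, hf⟩ := hf
    obtain ⟨i, hi⟩ : ∃ i, i ∉ S := by
      by_contra! h
      have : S = Finset.univ := Finset.eq_univ_iff_forall.2 h
      simp [this] at hS
      omega
    -- Flipping a coordinate outside `S` changes the parity but not `f`, so the terms cancel in
    -- pairs.
    refine Finset.sum_involution (fun x _ => Function.update x i (!x i)) ?_ ?_ ?_ ?_
    · intro x _
      rw [neg_one_pow_cubeWeight_update, hf (Function.update x i (!x i)) x fun j hj =>
        Function.update_of_ne (fun h => hi (by rwa [← h])) _ _]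
      ring
    · intro x _ _ h
      have := congrFun h i
      simp at this
    · simp
    · intro x _
      simp
  | zero => simp
  | add f g _ _ hf hg => simp [mul_add, Finset.sum_add_distrib, hf, hg]
  | smul c f _ hf =>
    simp only [Pi.smul_apply, smul_eq_mul, mul_left_comm _ c, ← Finset.mul_sum, hf, mul_zero]

/-- Functions that uniformly approximate all threshold functions of `m` bits cannot all have
degree less than `m`. -/
theorem le_degree_of_approx_thresholds {m d : ℕ} (r : ℕ → (Fin m → Bool) → ℝ) (ε : ℝ)
    (hr : ∀ t < m, (fun x => (r t x : ℂ)) ∈ lowDegree m d)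
    (happ : ∀ t < m, ∀ x, |r t x - if t < cubeWeight x then 1 else 0| ≤ ε)
    (hε : m * ε < 1 / 2) : m ≤ d := by
  by_contra! hd
  have h1 : ∑ x : Fin m → Bool, (-1 : ℝ) ^ cubeWeight x = 0 := by
    have := sum_parity_mul_eq_zero hd (lowDegree.const d 1)
    simp only [mul_one] at this
    exact_mod_cast this
  have h2 : ∑ x : Fin m → Bool, (-1 : ℝ) ^ cubeWeight x *
      ∑ t ∈ Finset.range m, (-1) ^ t * r t x = 0 := by
    have := sum_parity_mul_eq_zero hd (f := fun x => ∑ t ∈ Finset.range m, (-1) ^ t * (r t x : ℂ))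
      (lowDegree.sum _ _ fun t ht =>
        Submodule.smul_mem _ ((-1 : ℂ) ^ t) (hr t (Finset.mem_range.1 ht)))
    exact_mod_cast this
  -- The thresholds telescope to (1 - (-1)^|x|)/2, whose product with (-1)^|x| averages to -1/2; an
  -- error `m * ε` below 1/2 cannot bring this up to 0.
  have h3 : ∀ x : Fin m → Bool, (-1 : ℝ) ^ cubeWeight x *
      ∑ t ∈ Finset.range m, (-1) ^ t * r t x ≤ ((-1) ^ cubeWeight x - 1) / 2 + m * ε := by
    intro x
    have e1 : ∑ t ∈ Finset.range m, (-1 : ℝ) ^ t * (if t < cubeWeight x then 1 else 0) =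
        (1 - (-1) ^ cubeWeight x) / 2 := by
      have : (Finset.range m).filter (· < cubeWeight x) = Finset.range (cubeWeight x) := by
        ext t
        have := cubeWeight_le x
        simp
        omega
      simp only [mul_ite, mul_one, mul_zero]
      rw [← Finset.sum_filter, this, neg_one_geom_sum]
      split_ifs with h
      · simp [h.neg_one_pow]
      · rw [(Nat.not_even_iff_odd.1 h).neg_one_pow]
        norm_num
    have e2 : |∑ t ∈ Finset.range m, (-1 : ℝ) ^ t * r t x - (1 - (-1) ^ cubeWeight x) / 2| ≤
        m * ε := by
      rw [← e1, ← Finset.sum_sub_distrib]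
      refine (Finset.abs_sum_le_sum_abs _ _).trans ?_
      refine (Finset.sum_le_card_nsmul _ _ ε fun t ht => ?_).trans (by simp)
      rw [← mul_sub, abs_mul, abs_pow, abs_neg, abs_one, one_pow, one_mul]
      exact happ t (Finset.mem_range.1 ht) x
    rw [abs_le] at e2
    rcases neg_one_pow_eq_or ℝ (cubeWeight x) with h | h <;> rw [h] at e2 ⊢ <;> linarith
  have h4 := Finset.sum_le_sum fun x (_ : x ∈ Finset.univ) => h3 x
  rw [h2, Finset.sum_add_distrib, ← Finset.sum_div, Finset.sum_sub_distrib, h1] at h4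
  simp only [Finset.sum_const, nsmul_eq_mul, Finset.card_univ, mul_one] at h4
  have : 0 < (Fintype.card (Fin m → Bool) : ℝ) := by exact_mod_cast Fintype.card_pos
  nlinarith

/-! ### Amplification of success probabilities -/

/-- The probability that the majority of three independent trials of probability `p` succeeds. -/
def majorityOfThree (p : ℝ) : ℝ := 3 * p ^ 2 - 2 * p ^ 3

/-- This symmetry lets one error bound near 0 also serve probabilities near 1. -/
theorem majorityOfThree_one_sub (p : ℝ) : majorityOfThree (1 - p) = 1 - majorityOfThree p := by
  unfold majorityOfThree
  ring

theorem majorityOfThree_iterate_one_sub (j : ℕ) (p : ℝ) :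
    majorityOfThree^[j] (1 - p) = 1 - majorityOfThree^[j] p := by
  induction j generalizing p with
  | zero => rfl
  | succ j ih => rw [Function.iterate_succ_apply, Function.iterate_succ_apply,
      majorityOfThree_one_sub, ih]

theorem majorityOfThree_mem {p e : ℝ} (hp : 0 ≤ p) (hpe : p ≤ e) (he : e ≤ 1) :
    0 ≤ majorityOfThree p ∧ majorityOfThree p ≤ majorityOfThree e := by
  unfold majorityOfThree
  constructor
  · nlinarith [mul_nonneg (sq_nonneg p) (by linarith : 0 ≤ 3 - 2 * p)]
  · nlinarith [mul_nonneg (sub_nonneg.2 hpe) (mul_nonneg hp (sub_nonneg.2 he)),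
      mul_nonneg (sub_nonneg.2 hpe) (mul_nonneg hp (sub_nonneg.2 (hpe.trans he))),
      mul_nonneg (sub_nonneg.2 hpe) (mul_nonneg (hp.trans hpe) (sub_nonneg.2 he)),
      mul_nonneg (sub_nonneg.2 hpe) (hp.trans hpe), mul_nonneg (sub_nonneg.2 hpe) hp]

/-- The first round maps 1/3 to 7/27 = 1/3 · 7/9; after that, 3e² at e = q/3 is q²/3, so q is
squared in each round. -/
theorem majorityOfThree_iterate_le (j : ℕ) {p : ℝ} (hp : 0 ≤ p) (hp' : p ≤ 1 / 3) :
    0 ≤ majorityOfThree^[j + 1] p ∧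
      majorityOfThree^[j + 1] p ≤ 1 / 3 * (7 / 9) ^ 2 ^ j := by
  induction j with
  | zero =>
    have := majorityOfThree_mem hp hp' (by norm_num)
    refine ⟨this.1, this.2.trans ?_⟩
    norm_num [majorityOfThree]
  | succ j ih =>
    rw [Function.iterate_succ_apply']
    have h1 : ((7 : ℝ) / 9) ^ 2 ^ j ≤ 1 := pow_le_one₀ (by norm_num) (by norm_num)
    have := majorityOfThree_mem ih.1 ih.2 (by linarith)
    refine ⟨this.1, this.2.trans ?_⟩
    rw [pow_succ 2 j, pow_mul]
    have h2 : (0 : ℝ) ≤ (7 / 9) ^ 2 ^ j := by positivity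
    unfold majorityOfThree
    nlinarith [pow_nonneg h2 3]

/-- Amplification acts on the polynomial alone, never on the algorithm: each round composes with a
cubic and triples the degree. -/
theorem lowDegree.majorityOfThree_iterate {m d : ℕ} {p : (Fin m → Bool) → ℝ}
    (hp : (fun x => (p x : ℂ)) ∈ lowDegree m d) (j : ℕ) :
    (fun x => ((majorityOfThree^[j] (p x) : ℝ) : ℂ)) ∈ lowDegree m (3 ^ j * d) := by
  induction j with
  | zero => simpa using hp
  | succ j ih =>
    have h2 := lowDegree.mul ih ih
    have h3 := lowDegree.mul h2 ih
    have h4 := sub_mem (Submodule.smul_mem _ (3 : ℂ) (lowDegree.mono (by omega) h2))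
      (Submodule.smul_mem _ (2 : ℂ) h3)
    rw [show 3 ^ (j + 1) * d = 3 ^ j * d + 3 ^ j * d + 3 ^ j * d by ring]
    convert h4 using 1
    ext x
    simp only [Function.iterate_succ_apply', majorityOfThree, Pi.sub_apply, Pi.smul_apply,
      smul_eq_mul]
    push_cast
    ring

/-! ### Query algorithms -/

section Query

variable {α : Type} {n b w k : ℕ}

theorem queryAction_involutive (code : α ↪ BitVec b) (A B : RLEString α n) :
    Function.Involutive (queryAction (w := w) k code A B) := by
  rintro ⟨_ | ⟨_ | _, i⟩, c, r, z⟩ <;> simp [queryAction]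

theorem queryMatrix_mulVec (code : α ↪ BitVec b) (A B : RLEString α n)
    (v : QueryBasis n b w k → ℂ) (y : QueryBasis n b w k) :
    (queryMatrix k code A B).mulVec v y = v (queryAction k code A B y) := by
  have h : ∀ z, (y = queryAction k code A B z) ↔ queryAction k code A B y = z := fun z =>
    ⟨fun h => by rw [h, queryAction_involutive], fun h => by rw [← h, queryAction_involutive]⟩
  simp [queryMatrix, Matrix.mulVec, dotProduct, h]

theorem sum_sq_norm_unitary_mulVec {ι : Type*} [Fintype ι] [DecidableEq ι]
    (U : Matrix.unitaryGroup ι ℂ) (v : ι → ℂ) :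
    ∑ i, ‖U.1.mulVec v i‖ ^ 2 = ∑ i, ‖v i‖ ^ 2 := by
  have h : ∀ u : ι → ℂ, ((∑ i, ‖u i‖ ^ 2 : ℝ) : ℂ) = star u ⬝ᵥ u := fun u => by
    push_cast
    simp only [dotProduct, Pi.star_apply]
    exact Finset.sum_congr rfl fun i _ => (Complex.conj_mul' (u i)).symm
  have : ((∑ i, ‖U.1.mulVec v i‖ ^ 2 : ℝ) : ℂ) = ((∑ i, ‖v i‖ ^ 2 : ℝ) : ℂ) := by
    rw [h, h, Matrix.star_mulVec, Matrix.dotProduct_mulVec, Matrix.vecMul_vecMul,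
      ← Matrix.star_eq_conjTranspose, Matrix.mem_unitaryGroup_iff'.1 U.2, Matrix.vecMul_one]
  exact_mod_cast this

namespace QueryAlgorithm

variable (Q : QueryAlgorithm n b w k) (code : α ↪ BitVec b)

theorem sum_sq_norm_state (A B : RLEString α n) (t : ℕ) :
    ∑ x, ‖Q.state code A B t x‖ ^ 2 = 1 := by
  induction t with
  | zero =>
    rw [state, sum_sq_norm_unitary_mulVec, Finset.sum_eq_single Q.init]
    · simp
    · intro y _ hy
      simp [hy]
    · simp
  | succ t ih =>
    rw [state, sum_sq_norm_unitary_mulVec, ← ih]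
    simp only [queryMatrix_mulVec]
    exact Equiv.sum_comp (queryAction_involutive code A B).toPerm
      fun x => ‖Q.state code A B t x‖ ^ 2

theorem outputProb_nonneg (A B : RLEString α n) (P : ℕ → Prop) :
    0 ≤ Q.outputProb code A B P :=
  Finset.sum_nonneg fun x _ => by split_ifs <;> positivity

theorem outputProb_mono (A B : RLEString α n) {P R : ℕ → Prop} (h : ∀ l, P l → R l) :
    Q.outputProb code A B P ≤ Q.outputProb code A B R :=
  Finset.sum_le_sum fun x _ => by
    split_ifs with h1 h2
    · rfl
    · exact absurd (h _ h1) h2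
    · positivity
    · rfl

theorem outputProb_add_not (A B : RLEString α n) (P : ℕ → Prop) :
    Q.outputProb code A B P + Q.outputProb code A B (fun l => ¬ P l) = 1 := by
  rw [← Q.sum_sq_norm_state code A B Q.queries, outputProb, outputProb, ← Finset.sum_add_distrib]
  refine Finset.sum_congr rfl fun x _ => ?_
  by_cases h : P (Q.output x) <;> simp [h]

/-- `A` and `B` are inputs that depend on `m` bits, each run on at most one of them. -/
def DependsOnOneBit {m : ℕ} (A : (Fin m → Bool) → RLEString α n) : Prop :=
  ∀ i, ∃ S : Finset (Fin m), S.card ≤ 1 ∧ ∀ x y, (∀ j ∈ S, x j = y j) →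
    (A x).char i = (A y).char i ∧ (A x).run i = (A y).run i

variable {m : ℕ} {A B : (Fin m → Bool) → RLEString α n}

theorem queryAction_depends (hA : DependsOnOneBit A) (hB : DependsOnOneBit B)
    (u : QueryBasis n b w k) : ∃ S : Finset (Fin m), S.card ≤ 1 ∧ ∀ x y, (∀ j ∈ S, x j = y j) →
      queryAction k code (A x) (B x) u = queryAction k code (A y) (B y) u := by
  obtain ⟨_ | ⟨_ | _, i⟩, c, r, z⟩ := u
  · exact ⟨∅, by simp, fun _ _ _ => rfl⟩
  · obtain ⟨S, hS, h⟩ := hA i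
    exact ⟨S, hS, fun x y hxy => by simp only [queryAction, h x y hxy]⟩
  · obtain ⟨S, hS, h⟩ := hB i
    exact ⟨S, hS, fun x y hxy => by simp only [queryAction, h x y hxy]⟩

/-- The unitaries are constant in x and each entry of the query matrix depends on at most one bit,
so a query raises the degree by at most one. -/
theorem state_mem_lowDegree (hA : DependsOnOneBit A) (hB : DependsOnOneBit B) (t : ℕ)
    (z : QueryBasis n b w k) : (fun x => Q.state code (A x) (B x) t z) ∈ lowDegree m t := by
  induction t generalizing z with
  | zero => exact lowDegree.const 0 _
  | succ t ih =>
    simp only [state, Matrix.mulVec, dotProduct]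
    refine lowDegree.sum _ _ fun y _ => Submodule.smul_mem _ _ (lowDegree.sum _ _ fun u _ => ?_)
    rw [add_comm]
    refine lowDegree.mul ?_ (ih u)
    obtain ⟨S, hS, h⟩ := queryAction_depends code hA hB u
    refine lowDegree.of_junta S hS fun x y hxy => ?_
    simp only [queryMatrix, Matrix.of_apply]
    exact if_congr (by rw [h x y hxy]) rfl rfl

/-- The polynomial method: an output probability after `T` queries has degree at most `2 T`. -/
theorem outputProb_mem_lowDegree (hA : DependsOnOneBit A) (hB : DependsOnOneBit B)
    (P : ℕ → Prop) :
    (fun x => (Q.outputProb code (A x) (B x) P : ℂ)) ∈ lowDegree m (Q.queries + Q.queries) := by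
  simp only [outputProb, Complex.ofReal_sum]
  refine lowDegree.sum _ _ fun z _ => ?_
  split_ifs
  · have h := Q.state_mem_lowDegree code hA hB Q.queries z
    convert lowDegree.mul (lowDegree.conj h) h using 1
    ext x
    rw [Complex.conj_mul']
    push_cast
    rfl
  · exact lowDegree.const _ _

end QueryAlgorithm

end Query

/-! ### The hard inputs -/

section Hard

variable {α : Type}

theorem RLEString.mem_decode {n : ℕ} (S : RLEString α n) (y : α) :
    y ∈ S.decode ↔ ∃ i, S.char i = y := by
  simp only [decode, List.mem_flatten, List.mem_ofFn]
  constructor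
  · rintro ⟨_, ⟨i, rfl⟩, h⟩
    exact ⟨i, (List.eq_of_mem_replicate h).symm⟩
  · rintro ⟨i, rfl⟩
    exact ⟨_, ⟨i, rfl⟩, List.mem_replicate.2 ⟨by have := S.run_pos i; omega, rfl⟩⟩

/-- Reads the needed information about the encoded length off the letters of the decoded string. -/
theorem RLEString.two_le_iff {n : ℕ} (S : RLEString α n) :
    2 ≤ n ↔ ∃ y ∈ S.decode, ∃ z ∈ S.decode, y ≠ z := by
  simp only [mem_decode]
  constructor
  · intro h
    exact ⟨_, ⟨⟨0, by omega⟩, rfl⟩, _, ⟨⟨1, h⟩, rfl⟩, S.char_ne 0 h⟩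
  · rintro ⟨_, ⟨i, rfl⟩, _, ⟨j, rfl⟩, h⟩
    by_contra! hn
    exact h (congrArg _ (Fin.ext (by omega)))

theorem infix_append_cases {t u v : List α} (h : t <:+: u ++ v) :
    t <:+: u ∨ t <:+: v ∨ ∃ t₁ t₂, t = t₁ ++ t₂ ∧ t₂ ≠ [] ∧ t₁ <:+ u ∧ t₂ <+: v := by
  rw [List.infix_append_iff] at h
  rcases h with h | h | ⟨t₁, t₂, h, h1, h2⟩
  · exact .inl h
  · exact .inr (.inl h)
  · by_cases h0 : t₂ = []
    · subst h0
      exact .inl (by simpa [h] using h1.isInfix)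
    · exact .inr (.inr ⟨t₁, t₂, h, h0, h1, h2⟩)

/-- A common substring of `u cˢ` and `cˢ u`, where `c` does not occur in `u`, lies in `u` or
consists of `c` only. -/
theorem common_infix_cases {u t : List α} {c : α} {s : ℕ} (hc : c ∉ u)
    (h1 : t <:+: u ++ List.replicate s c) (h2 : t <:+: List.replicate s c ++ u) :
    t <:+: u ∨ ∀ y ∈ t, y = c := by
  have hrep : ∀ y ∈ List.replicate s c, y = c := fun y hy => List.eq_of_mem_replicate hy
  rcases infix_append_cases h1 with h | h | ⟨t₁, t₂, rfl, h0, ha, hb⟩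
  · exact .inl h
  · exact .inr fun y hy => hrep y (h.subset hy)
  rcases infix_append_cases h2 with h | h | ⟨u₁, u₂, he, h0', ha', hb'⟩
  · exact .inr fun y hy => hrep y (h.subset hy)
  · exact .inl h
  exfalso
  -- If `t` straddles both boundaries, its last letter is `c` by the first splitting and a letter of
  -- `u` by the second.
  have e : t₂.getLast h0 = u₂.getLast h0' := by
    rw [← List.getLast_append_of_ne_nil (l := t₁) (by simp [h0]) h0,
      ← List.getLast_append_of_ne_nil (l := u₁) (by simp [h0']) h0']
    simp only [he]
  refine hc (hb'.subset ?_)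
  rw [← hrep _ (hb.subset (List.getLast_mem h0)), e]
  exact List.getLast_mem h0'

theorem length_le_of_forall_eq {u t : List α} {c : α} {s : ℕ} (hc : c ∉ u)
    (h1 : t <:+: u ++ List.replicate s c) (h : ∀ y ∈ t, y = c) : t.length ≤ s := by
  classical
  rw [← List.count_eq_length.2 fun y hy => (h y hy).symm]
  refine (h1.sublist.count_le c).trans ?_
  simp [List.count_eq_zero_of_not_mem hc]

/-- The string whose `i`-th run has length `1 + 2 xᵢ`, with alternating characters `a` and `b`. -/
def bitString (a b : α) {m : ℕ} (x : Fin m → Bool) : List α :=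
  (List.ofFn fun i : Fin m =>
    List.replicate (1 + 2 * (x i).toNat) (if Even (i : ℕ) then a else b)).flatten

theorem length_bitString (a b : α) {m : ℕ} (x : Fin m → Bool) :
    (bitString a b x).length = m + 2 * cubeWeight x := by
  simp [bitString, List.length_flatten, List.map_ofFn, List.sum_ofFn, Function.comp_def,
    Finset.sum_add_distrib, cubeWeight, Finset.mul_sum]

theorem mem_bitString (a b : α) {m : ℕ} (x : Fin m → Bool) (y : α) :
    y ∈ bitString a b x ↔ ∃ i : Fin m, (if Even (i : ℕ) then a else b) = y := by
  simp only [bitString, List.mem_flatten, List.mem_ofFn]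
  constructor
  · rintro ⟨_, ⟨i, rfl⟩, h⟩
    exact ⟨i, (List.eq_of_mem_replicate h).symm⟩
  · rintro ⟨i, rfl⟩
    exact ⟨_, ⟨i, rfl⟩, List.mem_replicate.2 ⟨by omega, rfl⟩⟩

theorem alternate_ne {a b : α} (hab : a ≠ b) (i : ℕ) :
    (if Even i then a else b) ≠ if Even (i + 1) then a else b := by
  by_cases h : Even i <;> simp [h, Nat.even_add_one, hab, hab.symm]

/-- The input that decodes to `bitString a b x` followed by `s` copies of `c`. -/
def bitsThenRun {a b c : α} (hab : a ≠ b) (hac : a ≠ c) (hbc : b ≠ c) {s : ℕ} (hs : 1 ≤ s)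
    {m : ℕ} (x : Fin m → Bool) : RLEString α (m + 1) where
  char i := if (i : ℕ) = m then c else if Even (i : ℕ) then a else b
  run i := if h : (i : ℕ) < m then 1 + 2 * (x ⟨i, h⟩).toNat else s
  run_pos i := by split_ifs <;> omega
  char_ne i h := by
    have h1 : i ≠ m := by omega
    by_cases h2 : i + 1 = m
    · simp only [h1, h2, if_true, if_false]
      split_ifs <;> assumption
    · simpa only [h1, h2, if_false] using alternate_ne hab i

/-- The input that decodes to `s` copies of `c` followed by `bitString a b x`. -/
def runThenBits {a b c : α} (hab : a ≠ b) (hac : a ≠ c) {s : ℕ} (hs : 1 ≤ s)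
    {m : ℕ} (x : Fin m → Bool) : RLEString α (m + 1) where
  char := Fin.cons c fun i : Fin m => if Even (i : ℕ) then a else b
  run := Fin.cons s fun i : Fin m => 1 + 2 * (x i).toNat
  run_pos i := by cases i using Fin.cases <;> simp [hs]
  char_ne i h := by
    cases i with
    | zero =>
      show c ≠ (if Even 0 then a else b)
      simpa using hac.symm
    | succ i => exact alternate_ne hab i

variable {a b c : α} (hab : a ≠ b) (hac : a ≠ c) (hbc : b ≠ c) {s : ℕ} (hs : 1 ≤ s) {m : ℕ}

theorem decode_bitsThenRun (x : Fin m → Bool) :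
    (bitsThenRun hab hac hbc hs x).decode = bitString a b x ++ List.replicate s c := by
  rw [RLEString.decode, List.ofFn_succ_last]
  simp [bitsThenRun, bitString, (Fin.is_lt _).ne]

theorem decode_runThenBits (x : Fin m → Bool) :
    (runThenBits hab hac hs x).decode = List.replicate s c ++ bitString a b x := by
  rw [RLEString.decode, List.ofFn_succ]
  simp [runThenBits, bitString]

theorem dependsOnOneBit_bitsThenRun :
    QueryAlgorithm.DependsOnOneBit fun x : Fin m → Bool => bitsThenRun hab hac hbc hs x := by
  intro i
  by_cases h : (i : ℕ) < m
  · exact ⟨{⟨i, h⟩}, by simp, fun x y hxy => by simp [bitsThenRun, h, hxy ⟨i, h⟩ (by simp)]⟩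
  · exact ⟨∅, by simp, fun x y _ => by simp [bitsThenRun, h]⟩

theorem dependsOnOneBit_runThenBits :
    QueryAlgorithm.DependsOnOneBit fun x : Fin m → Bool => runThenBits hab hac hs x := by
  intro i
  cases i using Fin.cases with
  | zero => exact ⟨∅, by simp, fun x y _ => by simp [runThenBits]⟩
  | succ i => exact ⟨{i}, by simp, fun x y hxy => by simp [runThenBits, hxy i (by simp)]⟩

theorem notMem_bitString {a b c : α} (hac : a ≠ c) (hbc : b ≠ c) {m : ℕ} (x : Fin m → Bool) :
    c ∉ bitString a b x := by
  rw [mem_bitString]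
  rintro ⟨i, h⟩
  split_ifs at h
  exacts [hac h, hbc h]

theorem two_le_of_isEncodedLengthOfLCS (hm : 2 ≤ m) (x : Fin m → Bool)
    (h : s < m + 2 * cubeWeight x) {l : ℕ}
    (hl : IsEncodedLengthOfLCS (bitsThenRun hab hac hbc hs x) (runThenBits hab hac hs x) l) :
    2 ≤ l := by
  obtain ⟨v, h1, h2, h3⟩ := hl
  rw [decode_bitsThenRun] at h1 h3
  rw [decode_runThenBits] at h2 h3
  have hc := notMem_bitString hac hbc x
  have hlen := h3 _ (List.prefix_append _ _).isInfix (List.suffix_append _ _).isInfix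
  rcases common_infix_cases hc h1 h2 with hv | hv
  · have e := hv.eq_of_length (le_antisymm hv.length_le hlen)
    rw [v.two_le_iff, e]
    refine ⟨a, (mem_bitString ..).2 ⟨⟨0, by omega⟩, by simp⟩,
      b, (mem_bitString ..).2 ⟨⟨1, by omega⟩, by simp⟩, hab⟩
  · have := length_le_of_forall_eq hc h1 hv
    rw [length_bitString] at hlen
    omega

theorem not_two_le_of_isEncodedLengthOfLCS (x : Fin m → Bool)
    (h : m + 2 * cubeWeight x < s) {l : ℕ}
    (hl : IsEncodedLengthOfLCS (bitsThenRun hab hac hbc hs x) (runThenBits hab hac hs x) l) :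
    ¬ 2 ≤ l := by
  obtain ⟨v, h1, h2, h3⟩ := hl
  rw [decode_bitsThenRun] at h1 h3
  rw [decode_runThenBits] at h2 h3
  have hlen := h3 _ (List.suffix_append _ _).isInfix (List.prefix_append _ _).isInfix
  rw [List.length_replicate] at hlen
  rcases common_infix_cases (notMem_bitString hac hbc x) h1 h2 with hv | hv
  · have := hv.length_le
    rw [length_bitString] at this
    omega
  · rw [v.two_le_iff]
    rintro ⟨y, hy, z, hz, hyz⟩
    exact hyz ((hv y hy).trans (hv z hz).symm)

end Hard

/-! ### From thresholds to the query bound -/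

/-- An algorithm for EL-LCS-RLE makes enough queries to compute all threshold functions of `m`
bits with small error by `j + 1` rounds of amplification. -/
theorem le_queries_of_solvesELLCSRLE {α : Type} {m N b w k : ℕ} {a₁ a₂ a₃ : α} (h12 : a₁ ≠ a₂)
    (h13 : a₁ ≠ a₃) (h23 : a₂ ≠ a₃) (hm : 2 ≤ m) (hN : 8 * (m + 1) ≤ N) (code : α ↪ BitVec b)
    (Q : QueryAlgorithm (m + 1) b w k) (hQ : Q.SolvesELLCSRLE code N) (j : ℕ)
    (hj : (m : ℝ) * (1 / 3 * (7 / 9) ^ 2 ^ j) < 1 / 2) :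
    m ≤ 3 ^ (j + 1) * (Q.queries + Q.queries) := by
  -- The run length m + 2t + 1 differs in parity from m + 2|x|, the length of the bit string, so
  -- ties never occur.
  have hs : ∀ t, 1 ≤ m + 2 * t + 1 := fun t => by omega
  let A := fun (t : ℕ) (x : Fin m → Bool) => bitsThenRun h12 h13 h23 (hs t) x
  let B := fun (t : ℕ) (x : Fin m → Bool) => runThenBits h12 h13 (hs t) x
  refine le_degree_of_approx_thresholds
    (fun t x => majorityOfThree^[j + 1] (Q.outputProb code (A t x) (B t x) (2 ≤ ·))) _
    (fun t _ => lowDegree.majorityOfThree_iterate (Q.outputProb_mem_lowDegree code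
      (dependsOnOneBit_bitsThenRun h12 h13 h23 (hs t))
      (dependsOnOneBit_runThenBits h12 h13 (hs t)) _) _) (fun t ht x => ?_) hj
  have hx := cubeWeight_le x
  have hcorrect := hQ (A t x) (B t x)
    (by
      simp only [A, decode_bitsThenRun, List.length_append, length_bitString,
        List.length_replicate]
      omega)
    (by
      simp only [B, decode_runThenBits, List.length_append, length_bitString,
        List.length_replicate]
      omega)
  have hadd := Q.outputProb_add_not code (A t x) (B t x) (2 ≤ ·)
  split_ifs with h
  · have h1 := hcorrect.trans (Q.outputProb_mono code _ _ fun l hl =>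
      two_le_of_isEncodedLengthOfLCS h12 h13 h23 (hs t) hm x (by omega) hl)
    have := majorityOfThree_iterate_le j
      (p := 1 - Q.outputProb code (A t x) (B t x) (2 ≤ ·))
      (by linarith [Q.outputProb_nonneg code (A t x) (B t x) fun l => ¬ 2 ≤ l]) (by linarith)
    rw [majorityOfThree_iterate_one_sub] at this
    rw [abs_le]
    constructor <;> linarith
  · have h1 := hcorrect.trans (Q.outputProb_mono code _ _ fun l hl =>
      not_two_le_of_isEncodedLengthOfLCS h12 h13 h23 (hs t) x (by omega) hl)
    have := majorityOfThree_iterate_le j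
      (p := Q.outputProb code (A t x) (B t x) (2 ≤ ·))
      (Q.outputProb_nonneg code _ _ _) (by linarith)
    rw [sub_zero, abs_le]
    constructor <;> linarith

theorem mainTheorem4 :
    ∃ c : ℝ, 0 < c ∧ ∃ n₀ : ℕ, ∀ n : ℕ, n₀ ≤ n →
      ∀ (α : Type) [Fintype α], 5 ≤ Fintype.card α →
      ∀ N : ℕ, 8 * n ≤ N →
      ∀ (b w k : ℕ) (code : α ↪ BitVec b), N < 2 ^ w →
      ∀ Q : QueryAlgorithm n b w k, Q.SolvesELLCSRLE code N →
        c * ((n : ℝ) / Real.log n ^ 2) ≤ (Q.queries : ℝ) := by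
  -- 2916 = 9 · 81 · 2 · 2: two extra rounds, (9 log n)², degree 2T, and n ≤ 2m. From n ≥ 3 come m ≥
  -- 2 and log n ≥ 1.
  refine ⟨1 / 2916, by norm_num, 3, ?_⟩
  intro n hn α _ hα N hN b w k code _ Q hQ
  obtain ⟨a₁, a₂, a₃, h12, h13, h23⟩ := Fintype.two_lt_card_iff.1 (by omega : 2 < Fintype.card α)
  obtain ⟨m, rfl⟩ : ∃ m, n = m + 1 := ⟨n - 1, by omega⟩
  have hn' : (3 : ℝ) ≤ ((m + 1 : ℕ) : ℝ) := by exact_mod_cast hn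
  have hlog : 1 ≤ Real.log ((m + 1 : ℕ) : ℝ) := by
    rw [Real.le_log_iff_exp_le (by linarith)]
    linarith [Real.exp_one_lt_d9]
  have hmn : (m : ℝ) = ((m + 1 : ℕ) : ℝ) - 1 := by push_cast; ring
  generalize ((m + 1 : ℕ) : ℝ) = x at *
  -- 2^(j+1) exceeds 9 log x, so 7/9 ≤ exp(-2/9) makes the error factor at most 1/x; 2^j ≤ 9 log x
  -- bounds the degree growth through 3^j ≤ (2^j)².
  obtain ⟨j, hj1, hj2⟩ := exists_nat_pow_near (by linarith : 1 ≤ 9 * Real.log x)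
    (by norm_num : (1 : ℝ) < 2)
  have herr : ((7 : ℝ) / 9) ^ 2 ^ (j + 1) ≤ 1 / x := by
    calc ((7 : ℝ) / 9) ^ 2 ^ (j + 1) ≤ Real.exp (-(2 / 9)) ^ 2 ^ (j + 1) :=
          pow_le_pow_left₀ (by norm_num)
            (by linarith [Real.add_one_le_exp (-(2 / 9 : ℝ))]) _
      _ = Real.exp (2 ^ (j + 1) * -(2 / 9)) := by
          rw [← Real.exp_nat_mul]
          push_cast
          rfl
      _ ≤ Real.exp (-Real.log x) := Real.exp_le_exp.2 (by linarith)
      _ = 1 / x := by rw [Real.exp_neg, Real.exp_log (by linarith), one_div]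
  have hcount := le_queries_of_solvesELLCSRLE h12 h13 h23 (by omega) hN code Q hQ (j + 1) (by
    have : (m : ℝ) * (7 / 9) ^ 2 ^ (j + 1) ≤ 1 := by
      calc (m : ℝ) * (7 / 9) ^ 2 ^ (j + 1) ≤ x * (1 / x) :=
            mul_le_mul (by linarith) herr (by positivity) (by linarith)
        _ = 1 := mul_one_div_cancel (by linarith)
    linarith)
  have hcount' : (m : ℝ) ≤ 3 ^ (j + 1 + 1) * (Q.queries + Q.queries) := by exact_mod_cast hcount
  have hpow : (3 : ℝ) ^ j ≤ (9 * Real.log x) ^ 2 := by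
    calc (3 : ℝ) ^ j ≤ (2 ^ 2) ^ j := pow_le_pow_left₀ (by norm_num) (by norm_num) _
      _ = (2 ^ j) ^ 2 := by rw [← pow_mul, ← pow_mul, mul_comm]
      _ ≤ _ := pow_le_pow_left₀ (by positivity) hj1 _
  have hq : (0 : ℝ) ≤ Q.queries := Nat.cast_nonneg _
  have := mul_le_mul_of_nonneg_right hpow hq
  rw [← mul_div_assoc, div_le_iff₀ (by positivity)]
  rw [pow_succ, pow_succ] at hcount'
  linarith
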